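/- All spaces are Hausdorff. For a Tychonoff space $X$, a one-point extension of $X$ is a Tychonoff space $Y=X\cup\{p\}$, $p\notin X$, containing $X$ as a dense subspace. Two such extensions are identified if there is a homeomorphism between them fixing $X$ pointwise, and we write $Y_2\le Y_1$ if there is a continuous map $Y_1\to Y_2$ fixing $X$ pointwise; this is a partial order on the set $\mathcal T(X)$ of (classes of) one-point extensions of $X$. Let - $\mathcal T^*_S(X)$ be the set of all $Y=X\cup\{p\}\in\mathcal T(X)$ such that $Y$ is first countable at $p$ and $U\setminus\{p\}$ is $\sigma$-compact for some neighbourhood $U$ of $p$ in $Y$; - $\mathcal T_{CL}(X)$ be the set of all $Y\in\mathcal T(X)$ that are both Čech-complete (i.e. $Y$ is a $G_\delta$-set in its Stone–Čech compactification $\beta Y$) and Lindelöf; both ordered by $\le$. Finally let $$\sigma X=\bigcup\{\mathrm{cl}_{\beta X}A : A\subseteq X\text{ is }\sigma\text{-compact}\}\subseteq\beta X .$$ **Theorem.** Let $X$ and $Y$ be locally compact paracompact spaces. Then 1. $\mathcal T^*_S(X)$ and $\mathcal T^*_S(Y)$ are order-isomorphic if and only if $\sigma X\setminus X$ and $\sigma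 Y\setminus Y$ are homeomorphic; 2. $\mathcal T_{CL}(X)$ and $\mathcal T_{CL}(Y)$ are order-isomorphic if and only if $\sigma X\setminus X$ and $\sigma Y\setminus Y$ are homeomorphic. -/

import Mathlib

open Set Topology

universe u

/-- A one-point Tychonoff extension `Y = X ∪ {p}` of `X`: a Tychonoff space containing (a copy of)
`X` as a dense subspace, whose complement consists of the single point `p`. -/
structure OnePointExtension (X : Type u) [TopologicalSpace X] : Type (u + 1) where
  carrier : Type u
  [top : TopologicalSpace carrier]
  [tychonoff : T35Space carrier]
  emb : X → carrier
  isEmbedding : IsEmbedding emb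
  denseRange : DenseRange emb
  pt : carrier
  compl_range : (range emb)ᶜ = {pt}

namespace OnePointExtension

attribute [instance] OnePointExtension.top OnePointExtension.tychonoff

variable {X : Type u} [TopologicalSpace X]

/-- `Y₁` dominates `Y₂`: there is a continuous map `Y₁ → Y₂` that keeps `X` pointwise fixed. -/
def Dominates (Y₁ Y₂ : OnePointExtension X) : Prop :=
  ∃ f : Y₁.carrier → Y₂.carrier, Continuous f ∧ ∀ x, f (Y₁.emb x) = Y₂.emb x

/-- Equivalence: there is a homeomorphism `Y₁ ≃ₜ Y₂` that keeps `X` pointwise fixed. -/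
def Equivalent (Y₁ Y₂ : OnePointExtension X) : Prop :=
  ∃ f : Y₁.carrier ≃ₜ Y₂.carrier, ∀ x, f (Y₁.emb x) = Y₂.emb x

theorem Dominates.refl (Y : OnePointExtension X) : Dominates Y Y :=
  ⟨id, continuous_id, fun _ => rfl⟩

theorem Dominates.trans {Y₁ Y₂ Y₃ : OnePointExtension X}
    (h : Dominates Y₁ Y₂) (k : Dominates Y₂ Y₃) : Dominates Y₁ Y₃ := by
  obtain ⟨f, hf, hfx⟩ := h
  obtain ⟨g, hg, hgx⟩ := k
  exact ⟨g ∘ f, hg.comp hf, fun x => by simp [hfx, hgx]⟩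

theorem Equivalent.dominates {Y₁ Y₂ : OnePointExtension X} (h : Equivalent Y₁ Y₂) :
    Dominates Y₁ Y₂ := by
  obtain ⟨f, hf⟩ := h
  exact ⟨f, f.continuous, hf⟩

theorem Equivalent.symm {Y₁ Y₂ : OnePointExtension X} (h : Equivalent Y₁ Y₂) :
    Equivalent Y₂ Y₁ := by
  obtain ⟨f, hf⟩ := h
  exact ⟨f.symm, fun x => by rw [← hf x, f.symm_apply_apply]⟩

theorem Dominates.antisymm {Y₁ Y₂ : OnePointExtension X}
    (h : Dominates Y₁ Y₂) (k : Dominates Y₂ Y₁) : Equivalent Y₁ Y₂ := by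
  obtain ⟨f, hf, hfx⟩ := h
  obtain ⟨g, hg, hgx⟩ := k
  have h₁ : g ∘ f = id :=
    Y₁.denseRange.equalizer (hg.comp hf) continuous_id (funext fun x => by simp [hfx, hgx])
  have h₂ : f ∘ g = id :=
    Y₂.denseRange.equalizer (hf.comp hg) continuous_id (funext fun x => by simp [hfx, hgx])
  exact ⟨⟨⟨f, g, congrFun h₁, congrFun h₂⟩, hf, hg⟩, hfx⟩

instance setoid (X : Type u) [TopologicalSpace X] : Setoid (OnePointExtension X) where
  r := Equivalent
  iseqv :=
    { refl := fun Y => ⟨Homeomorph.refl _, fun _ => rfl⟩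
      symm := Equivalent.symm
      trans := fun h k => (h.dominates.trans k.dominates).antisymm
        (k.symm.dominates.trans h.symm.dominates) }

end OnePointExtension

/-- `𝒯(X)`: the equivalence classes of one-point Tychonoff extensions of `X`. -/
def OnePointExt (X : Type u) [TopologicalSpace X] : Type (u + 1) :=
  Quotient (OnePointExtension.setoid X)

namespace OnePointExt

variable (X : Type u) [TopologicalSpace X]

/-- `⟦Y₂⟧ ≤ ⟦Y₁⟧` iff there is a continuous map `Y₁ → Y₂` that keeps `X` pointwise fixed. -/
instance : LE (OnePointExt X) where
  le := Quotient.lift₂ (fun Y₂ Y₁ : OnePointExtension X => Y₁.Dominates Y₂)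
    (fun _ _ _ _ h k => propext
      ⟨fun d => (k.symm.dominates.trans d).trans h.dominates,
        fun d => (k.dominates.trans d).trans h.symm.dominates⟩)

instance : PartialOrder (OnePointExt X) where
  le_refl := by
    rintro ⟨Y⟩
    exact OnePointExtension.Dominates.refl Y
  le_trans := by
    rintro ⟨Y₁⟩ ⟨Y₂⟩ ⟨Y₃⟩ h k
    exact OnePointExtension.Dominates.trans k h
  le_antisymm := by
    rintro ⟨Y₁⟩ ⟨Y₂⟩ h k
    exact Quotient.sound (OnePointExtension.Dominates.antisymm k h)

/-- `𝒯*(X)`: the extensions that are first countable at the added point `p`. -/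
def firstCountable : Set (OnePointExt X) :=
  {q | ∃ Y : OnePointExtension X, Quotient.mk _ Y = q ∧ (𝓝 Y.pt).IsCountablyGenerated}

/-- `𝒯_S(X)`: the extensions in which `U \ {p}` is σ-compact for some neighbourhood `U` of `p`. -/
def sigmaCompactAt : Set (OnePointExt X) :=
  {q | ∃ Y : OnePointExtension X, Quotient.mk _ Y = q ∧ ∃ U ∈ 𝓝 Y.pt, IsSigmaCompact (U \ {Y.pt})}

/-- `𝒯*_S(X) = 𝒯*(X) ∩ 𝒯_S(X)`. -/
def starS : Set (OnePointExt X) := firstCountable X ∩ sigmaCompactAt X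

/-- `𝒯_C(X)`: the extensions `Y` that are Čech-complete, i.e. `Y` is a `G_δ`-set in `βY`. -/
def cechComplete : Set (OnePointExt X) :=
  {q | ∃ Y : OnePointExtension X, Quotient.mk _ Y = q ∧
    IsGδ (range (stoneCechUnit : Y.carrier → StoneCech Y.carrier))}

/-- `𝒯_L(X)`: the extensions that are Lindelöf. -/
def lindelof : Set (OnePointExt X) :=
  {q | ∃ Y : OnePointExtension X, Quotient.mk _ Y = q ∧ LindelofSpace Y.carrier}

/-- `𝒯_CL(X) = 𝒯_C(X) ∩ 𝒯_L(X)`. -/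
def cechCompleteLindelof : Set (OnePointExt X) := cechComplete X ∩ lindelof X

end OnePointExt

/-- `σX`: the union of the closures in `βX` of the σ-compact subsets of `X`. -/
def sigmaExt (X : Type u) [TopologicalSpace X] : Set (StoneCech X) :=
  ⋃ A ∈ {A : Set X | IsSigmaCompact A}, closure (stoneCechUnit '' A)

/-- `σX \ X`, as a subset of `βX`. -/
def sigmaRemainder (X : Type u) [TopologicalSpace X] : Set (StoneCech X) :=
  sigmaExt X \ range (stoneCechUnit : X → StoneCech X)

/-! A one-point extension `Y` of `X` is determined by the fibre `C` of the canonical map `βX → βY`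
over the added point `p`. By `collapse` and `fiber_collapse` every nonempty closed `C ⊆ βX \ X`
occurs, and a larger extension has a smaller fibre. The neighbourhoods of `p` trace on `X` the
neighbourhoods of `C`, so local properties of `Y` at `p` become properties of `C`: first countable
means that `C` is `G_δ` in `βX`; locally σ-compact off `p` means `C ⊆ σX`; Čech-complete means that
`(βX \ X) \ C` is σ-compact; Lindelöf means `βX \ σX ⊆ C`.

Paracompactness enters through one fact: a σ-compact subset of `X` lies in a clopen σ-compact one,
whose closure in `βX` is clopen. Hence `σX` is open, `σX \ X` is locally compact, and each compact
subset of `σX` lies in the closure of a single clopen σ-compact set. It follows that `𝒯*_S(X)` is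
anti-isomorphic to the nonempty compact `G_δ`-sets of `σX \ X`, via `C`, and `𝒯_CL(X)` is isomorphic
to its proper open σ-compact sets, via the complement of `C`.

Finally, a locally compact Hausdorff space can be recovered from either of these ordered sets:
points are reconstructed by compactness from the families of sets that contain, or avoid, them. -/

/-! ### Compact `G_δ`-sets and open σ-compact sets in locally compact spaces -/

section LocallyCompact

variable {S : Type*} [TopologicalSpace S] [T2Space S] [LocallyCompactSpace S]

/-- Take a superlevel set `f ≥ 1/2` of a compactly supported function with `f x = 1` that vanishes
off the interior of `W`. -/
theorem exists_isCompact_isGδ_subset {x : S} {W : Set S} (hW : W ∈ 𝓝 x) :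
    ∃ K ∈ 𝓝 x, IsCompact K ∧ IsGδ K ∧ K ⊆ W := by
  obtain ⟨f, hf1, hf0, hfc, -⟩ := exists_continuous_one_zero_of_isCompact
    (isCompact_singleton (x := x)) (isOpen_interior (s := W)).isClosed_compl
    (disjoint_compl_right_iff_subset.2 (singleton_subset_iff.2 (mem_interior_iff_mem_nhds.2 hW)))
  have hx : f x = 1 := hf1 rfl
  have hsub : f ⁻¹' Ici (1 / 2) ⊆ tsupport f := fun y hy => subset_tsupport _ (by
    have : (1 / 2 : ℝ) ≤ f y := hy
    simp only [Function.mem_support]; linarith)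
  refine ⟨f ⁻¹' Ici (1 / 2), ?_, hfc.isCompact.of_isClosed_subset
    (isClosed_Ici.preimage f.continuous) hsub, isClosed_Ici.isGδ.preimage f.continuous, ?_⟩
  · exact f.continuous.continuousAt.preimage_mem_nhds (Ici_mem_nhds (by rw [hx]; norm_num))
  · intro y hy
    by_contra hyW
    have : f y = 0 := hf0 (fun h => hyW (interior_subset h))
    have h2 : (1 / 2 : ℝ) ≤ f y := hy
    norm_num [this] at h2

theorem exists_isOpen_isSigmaCompact_subset {x : S} {W : Set S} (hW : W ∈ 𝓝 x) :
    ∃ U, x ∈ U ∧ IsOpen U ∧ IsSigmaCompact U ∧ U ⊆ W := by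
  obtain ⟨f, hf1, hf0, hfc, -⟩ := exists_continuous_one_zero_of_isCompact
    (isCompact_singleton (x := x)) (isOpen_interior (s := W)).isClosed_compl
    (disjoint_compl_right_iff_subset.2 (singleton_subset_iff.2 (mem_interior_iff_mem_nhds.2 hW)))
  have hx : f x = 1 := hf1 rfl
  -- The set `f > 0` is the union of the compact sets `f ≥ 1/(n+1)`.
  refine ⟨f ⁻¹' Ioi 0, by simp [hx], isOpen_Ioi.preimage f.continuous,
    ⟨fun n : ℕ => f ⁻¹' Ici (1 / ((n : ℝ) + 1)), fun n => ?_, ?_⟩, ?_⟩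
  · refine hfc.isCompact.of_isClosed_subset (isClosed_Ici.preimage f.continuous)
      fun y hy => subset_tsupport _ ?_
    exact (lt_of_lt_of_le Nat.one_div_pos_of_nat (show 1 / ((n : ℝ) + 1) ≤ f y from hy)).ne'
  · ext y
    simp only [mem_iUnion, mem_preimage, mem_Ici, mem_Ioi]
    exact ⟨fun ⟨n, hn⟩ => lt_of_lt_of_le Nat.one_div_pos_of_nat hn,
      fun hy => (exists_nat_one_div_lt hy).imp fun n hn => hn.le⟩
  · intro y hy
    by_contra hyW
    have : f y = 0 := hf0 (fun h => hyW (interior_subset h))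
    exact absurd this (ne_of_gt hy)

theorem IsCompact.exists_isCompact_isGδ_superset {C : Set S} (hC : IsCompact C) {x : S}
    (hx : x ∉ C) (hne : C.Nonempty) :
    ∃ K, IsCompact K ∧ IsGδ K ∧ K.Nonempty ∧ C ⊆ K ∧ x ∉ K := by
  obtain ⟨f, hf1, hf0, hfc, -⟩ := exists_continuous_one_zero_of_isCompact
    hC (isClosed_singleton (x := x)) (disjoint_singleton_right.2 hx)
  have hx0 : f x = 0 := hf0 rfl
  have hsub : C ⊆ f ⁻¹' Ici 1 := fun y hy => (hf1 hy).ge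
  refine ⟨f ⁻¹' Ici 1, hfc.isCompact.of_isClosed_subset (isClosed_Ici.preimage f.continuous)
    fun y hy => subset_tsupport _ ?_, isClosed_Ici.isGδ.preimage f.continuous, hne.mono hsub,
    hsub, ?_⟩
  · exact (lt_of_lt_of_le one_pos (show (1 : ℝ) ≤ f y from hy)).ne'
  · simp [hx0]

end LocallyCompact

/-- The nonempty compact `G_δ`-subsets of a space. -/
def CompactGδ (S : Type*) [TopologicalSpace S] : Type _ :=
  {K : Set S // IsCompact K ∧ IsGδ K ∧ K.Nonempty}

instance (S : Type*) [TopologicalSpace S] : PartialOrder (CompactGδ S) :=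
  inferInstanceAs (PartialOrder {K : Set S // IsCompact K ∧ IsGδ K ∧ K.Nonempty})

/-- The proper open σ-compact subsets of a space. -/
def ProperOpenSigma (S : Type*) [TopologicalSpace S] : Type _ :=
  {U : Set S // IsOpen U ∧ IsSigmaCompact U ∧ U ≠ univ}

instance (S : Type*) [TopologicalSpace S] : PartialOrder (ProperOpenSigma S) :=
  inferInstanceAs (PartialOrder {U : Set S // IsOpen U ∧ IsSigmaCompact U ∧ U ≠ univ})

/-! ### Transport of the two ordered sets along homeomorphisms -/

section Congr

variable {S T : Type*} [TopologicalSpace S] [TopologicalSpace T]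

theorem Homeomorph.isGδ_image (h : S ≃ₜ T) {K : Set S} (hK : IsGδ K) : IsGδ (h '' K) := by
  rw [h.image_eq_preimage_symm]; exact hK.preimage h.symm.continuous

/-- A homeomorphism transports compact `G_δ`-sets. -/
def Homeomorph.compactGδCongr (h : S ≃ₜ T) : CompactGδ S ≃o CompactGδ T where
  toFun K := ⟨h '' K.1, K.2.1.image h.continuous, h.isGδ_image K.2.2.1, K.2.2.2.image h⟩
  invFun K := ⟨h.symm '' K.1, K.2.1.image h.symm.continuous, h.symm.isGδ_image K.2.2.1,
    K.2.2.2.image h.symm⟩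
  left_inv K := Subtype.ext (by simp [image_image])
  right_inv K := Subtype.ext (by simp [image_image])
  map_rel_iff' {K L} := image_subset_image_iff h.injective

/-- A homeomorphism transports proper open σ-compact sets. -/
def Homeomorph.properOpenSigmaCongr (h : S ≃ₜ T) : ProperOpenSigma S ≃o ProperOpenSigma T where
  toFun U := ⟨h '' U.1, h.isOpenMap _ U.2.1, U.2.2.1.image h.continuous, fun e => U.2.2.2 (by
    rw [← h.preimage_image U.1, e, preimage_univ])⟩
  invFun U := ⟨h.symm '' U.1, h.symm.isOpenMap _ U.2.1, U.2.2.1.image h.symm.continuous,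
    fun e => U.2.2.2 (by rw [← h.symm.preimage_image U.1, e, preimage_univ])⟩
  left_inv K := Subtype.ext (by simp [image_image])
  right_inv K := Subtype.ext (by simp [image_image])
  map_rel_iff' {K L} := image_subset_image_iff h.injective

end Congr

/-- A one-to-one correspondence between points gives an equivalence. -/
theorem exists_equiv_of_rel {S T : Type*} (r : S → T → Prop) (h₁ : ∀ x, ∃ y, r x y)
    (h₂ : ∀ y, ∃ x, r x y) (u₁ : ∀ x y y', r x y → r x y' → y = y')
    (u₂ : ∀ x x' y, r x y → r x' y → x = x') : ∃ e : S ≃ T, ∀ x, r x (e x) := by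
  choose f hf using h₁
  choose g hg using h₂
  exact ⟨⟨f, g, fun x => u₂ _ _ _ (hg _) (hf x), fun y => u₁ _ _ _ (hf _) (hg y)⟩, hf⟩

/-! ### Recovering a space from its compact `G_δ`-sets -/

section CompactGδ

variable {S T : Type*} [TopologicalSpace S] [TopologicalSpace T]
  [T2Space S] [T2Space T] [LocallyCompactSpace S] [LocallyCompactSpace T]

theorem CompactGδ.eq_of_forall_mem {x y : S} (h : ∀ K : CompactGδ S, x ∈ K.1 → y ∈ K.1) :
    x = y := by
  by_contra hne
  obtain ⟨K, hK, hKc, hKg, hKs⟩ := exists_isCompact_isGδ_subset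
    (isOpen_compl_singleton.mem_nhds (show x ∈ ({y}ᶜ : Set S) from hne))
  exact hKs (h ⟨K, hKc, hKg, x, mem_of_mem_nhds hK⟩ (mem_of_mem_nhds hK)) rfl

omit [LocallyCompactSpace T] in
-- The sets `K` containing `x` are closed under intersection, so their images are a directed family
-- of nonempty compact sets, and these have a common point.
theorem CompactGδ.exists_forall_mem (e : CompactGδ S ≃o CompactGδ T) (x : S) :
    ∃ y, ∀ K, x ∈ K.1 → y ∈ (e K).1 := by
  obtain ⟨K₀, hK₀, hc, hg, -⟩ := exists_isCompact_isGδ_subset (Filter.univ_mem (f := 𝓝 x))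
  have : Nonempty {K : CompactGδ S // x ∈ K.1} :=
    ⟨⟨⟨K₀, hc, hg, x, mem_of_mem_nhds hK₀⟩, mem_of_mem_nhds hK₀⟩⟩
  obtain ⟨y, hy⟩ := IsCompact.nonempty_iInter_of_directed_nonempty_isCompact_isClosed
    (fun K : {K : CompactGδ S // x ∈ K.1} => (e K.1).1) (fun K L =>
      ⟨⟨⟨K.1.1 ∩ L.1.1, K.1.2.1.inter L.1.2.1, K.1.2.2.1.inter L.1.2.2.1, x, K.2, L.2⟩, K.2, L.2⟩,
        e.monotone inter_subset_left, e.monotone inter_subset_right⟩)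
    (fun K => (e K.1).2.2.2) (fun K => (e K.1).2.1) (fun K => (e K.1).2.1.isClosed)
  exact ⟨y, fun K hK => mem_iInter.1 hy ⟨K, hK⟩⟩

/-- Going to `y` and back by `e.symm` yields a point that lies in every `K` containing `x`, hence
`x` itself; the return trip then supplies the converse implication. -/
theorem CompactGδ.exists_forall_mem_iff (e : CompactGδ S ≃o CompactGδ T) (x : S) :
    ∃ y, ∀ K, x ∈ K.1 ↔ y ∈ (e K).1 := by
  obtain ⟨y, hy⟩ := exists_forall_mem e x
  obtain ⟨x', hx'⟩ := exists_forall_mem e.symm y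
  obtain rfl : x = x' := eq_of_forall_mem fun K hK => by simpa using hx' _ (hy K hK)
  exact ⟨y, fun K => ⟨hy K, fun h => by simpa using hx' _ h⟩⟩

/-- Near `x` the values of `h` stay in the compact set `e L'`. The part of it outside `interior V`
is compact and misses `h x`, so it is enclosed in a compact `G_δ`-set that still misses `h x`; the
corresponding set in `S` is closed and is avoided near `x`. -/
theorem CompactGδ.continuous_of_forall_mem_iff (e : CompactGδ S ≃o CompactGδ T) (h : S ≃ T)
    (he : ∀ x K, x ∈ K.1 ↔ h x ∈ (e K).1) : Continuous h := by
  refine continuous_iff_continuousAt.2 fun x => ?_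
  intro V hV
  change h ⁻¹' V ∈ 𝓝 x
  obtain ⟨L, hL, hLc, hLg, -⟩ := exists_isCompact_isGδ_subset (Filter.univ_mem (f := 𝓝 x))
  let L' : CompactGδ S := ⟨L, hLc, hLg, x, mem_of_mem_nhds hL⟩
  rcases ((e L').1 \ interior V).eq_empty_or_nonempty with hem | hne
  · filter_upwards [hL] with z hz
    exact interior_subset (s := V) (sdiff_eq_empty.1 hem ((he z L').1 hz))
  · obtain ⟨K, hKc, hKg, hKne, hsub, hxK⟩ := ((e L').2.1.diff
      isOpen_interior).exists_isCompact_isGδ_superset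
      (fun hx => hx.2 (mem_interior_iff_mem_nhds.2 hV)) hne
    let K' : CompactGδ T := ⟨K, hKc, hKg, hKne⟩
    have hxK' : x ∉ (e.symm K').1 := fun hx => hxK (by
      have := (he x _).1 hx
      rwa [e.apply_symm_apply] at this)
    filter_upwards [hL, (e.symm K').2.1.isClosed.isOpen_compl.mem_nhds hxK'] with z hz hzK
    by_contra hzV
    refine hzK ((he z _).2 ?_)
    rw [e.apply_symm_apply]
    exact hsub ⟨(he z L').1 hz, fun h => hzV (interior_subset (s := V) h)⟩

theorem CompactGδ.nonempty_homeomorph (e : CompactGδ S ≃o CompactGδ T) : Nonempty (S ≃ₜ T) := by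
  obtain ⟨h, hh⟩ := exists_equiv_of_rel (fun x y => ∀ K, x ∈ K.1 ↔ y ∈ (e K).1)
    (exists_forall_mem_iff e)
    (fun y => (exists_forall_mem_iff e.symm y).imp fun x hx K => by simpa using (hx (e K)).symm)
    (fun x y y' hy hy' => eq_of_forall_mem fun K hK => by
      simpa using (hy' (e.symm K)).1 ((hy (e.symm K)).2 (by simpa using hK)))
    (fun x x' y hx hx' => eq_of_forall_mem fun K hK => (hx' K).2 ((hx K).1 hK))
  refine ⟨⟨h, continuous_of_forall_mem_iff e h hh, ?_⟩⟩
  exact continuous_of_forall_mem_iff e.symm h.symm fun y K => by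
    rw [hh (h.symm y) (e.symm K)]; simp

end CompactGδ

/-! ### Recovering a space from its proper open σ-compact sets -/

section ProperOpenSigma

variable {S T : Type*} [TopologicalSpace S] [TopologicalSpace T]
  [T2Space S] [T2Space T] [LocallyCompactSpace S] [LocallyCompactSpace T]

theorem ProperOpenSigma.exists_mem_subset [Nontrivial S] {x : S} {W : Set S} (hW : W ∈ 𝓝 x) :
    ∃ U : ProperOpenSigma S, x ∈ U.1 ∧ U.1 ⊆ W := by
  obtain ⟨y, hy⟩ := exists_ne x
  obtain ⟨U, hxU, hU, hUs, hsub⟩ := exists_isOpen_isSigmaCompact_subset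
    (Filter.inter_mem hW (isOpen_compl_singleton.mem_nhds (show x ∈ ({y}ᶜ : Set S) from hy.symm)))
  exact ⟨⟨U, hU, hUs, fun h => (hsub (h ▸ mem_univ y)).2 rfl⟩, hxU,
    hsub.trans inter_subset_left⟩

theorem ProperOpenSigma.eq_of_forall_mem [Nontrivial S] {x y : S}
    (h : ∀ U : ProperOpenSigma S, x ∈ U.1 → y ∈ U.1) : x = y := by
  by_contra hne
  obtain ⟨U, hxU, hU⟩ := exists_mem_subset
    (isOpen_compl_singleton.mem_nhds (show x ∈ ({y}ᶜ : Set S) from hne))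
  exact hU (h U hxU) rfl

omit [LocallyCompactSpace T] in
-- The point `y` is sought in the intersection of the complements of the sets `e U` with `x ∉ U`.
-- These are directed but only closed, so they are first cut down to one compact set that meets all
-- of them.
theorem ProperOpenSigma.exists_forall_notMem [Nontrivial S]
    (e : ProperOpenSigma S ≃o ProperOpenSigma T) (x : S) :
    ∃ y, ∀ U, x ∉ U.1 → y ∉ (e U).1 := by
  obtain ⟨V, hxV, -⟩ := exists_mem_subset (Filter.univ_mem (f := 𝓝 x))
  obtain ⟨K, hKc, hKV⟩ := (e V).2.2.1
  -- Otherwise each `K n` lies in some `e (U n)` with `x ∉ U n`. The union `W` of the `U n` is still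
  -- proper since it misses `x`, yet `e V ≤ e W` forces `x ∈ V ⊆ W`.
  obtain ⟨n, hn⟩ : ∃ n, ∀ U : ProperOpenSigma S, x ∉ U.1 → ¬ K n ⊆ (e U).1 := by
    by_contra! hcon
    choose U hxU hKU using hcon
    have hxW : x ∉ ⋃ n, (U n).1 := by simpa using hxU
    let W : ProperOpenSigma S := ⟨⋃ n, (U n).1, isOpen_iUnion fun n => (U n).2.1,
      isSigmaCompact_iUnion _ fun n => (U n).2.2.1, (ne_univ_iff_exists_notMem _).2 ⟨x, hxW⟩⟩
    have hVW : e V ≤ e W := by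
      change (e V).1 ⊆ (e W).1
      rw [← hKV]
      exact iUnion_subset fun n => (hKU n).trans
        (e.monotone (show (U n).1 ⊆ W.1 from subset_iUnion (fun n => (U n).1) n))
    exact hxW (e.le_iff_le.1 hVW hxV)
  let ι := {U : ProperOpenSigma S // x ∉ U.1}
  have : Nonempty ι := by
    refine ⟨⟨⟨∅, isOpen_empty, isSigmaCompact_empty, ?_⟩, notMem_empty x⟩⟩
    exact fun h => notMem_empty x (h ▸ mem_univ x)
  obtain ⟨y, hy⟩ := IsCompact.nonempty_iInter_of_directed_nonempty_isCompact_isClosed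
    (fun U : ι => K n \ (e U.1).1) (fun U V => by
      have hx : x ∉ U.1.1 ∪ V.1.1 := by simp [U.2, V.2]
      refine ⟨⟨⟨U.1.1 ∪ V.1.1, U.1.2.1.union V.1.2.1, ?_, (ne_univ_iff_exists_notMem _).2 ⟨x, hx⟩⟩, hx⟩,
        sdiff_subset_sdiff_right (e.monotone subset_union_left),
        sdiff_subset_sdiff_right (e.monotone subset_union_right)⟩
      rw [union_eq_iUnion]
      exact isSigmaCompact_iUnion _ fun b => by cases b; exacts [V.1.2.2.1, U.1.2.2.1])
    (fun U => nonempty_of_not_subset (hn U.1 U.2))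
    (fun U => (hKc n).diff (e U.1).2.1) (fun U => ((hKc n).diff (e U.1).2.1).isClosed)
  exact ⟨y, fun U hU => (mem_iInter.1 hy ⟨U, hU⟩).2⟩

theorem ProperOpenSigma.exists_forall_mem_iff [Nontrivial S] [Nontrivial T]
    (e : ProperOpenSigma S ≃o ProperOpenSigma T) (x : S) :
    ∃ y, ∀ U, x ∈ U.1 ↔ y ∈ (e U).1 := by
  obtain ⟨y, hy⟩ := exists_forall_notMem e x
  obtain ⟨x', hx'⟩ := exists_forall_notMem e.symm y
  obtain rfl : x' = x := eq_of_forall_mem fun U hU => by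
    by_contra h
    exact hx' _ (hy U h) (by simpa using hU)
  refine ⟨y, fun U => ⟨fun h => ?_, fun h => ?_⟩⟩
  · by_contra h'
    exact hx' _ h' (by simpa using h)
  · by_contra h'
    exact hy U h' h

theorem ProperOpenSigma.nonempty_homeomorph_of_nontrivial [Nontrivial S] [Nontrivial T]
    (e : ProperOpenSigma S ≃o ProperOpenSigma T) : Nonempty (S ≃ₜ T) := by
  obtain ⟨h, hh⟩ := exists_equiv_of_rel (fun x y => ∀ U, x ∈ U.1 ↔ y ∈ (e U).1)
    (exists_forall_mem_iff e)
    (fun y => (exists_forall_mem_iff e.symm y).imp fun x hx U => by simpa using (hx (e U)).symm)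
    (fun x y y' hy hy' => eq_of_forall_mem fun U hU => by
      simpa using (hy' (e.symm U)).1 ((hy (e.symm U)).2 (by simpa using hU)))
    (fun x x' y hx hx' => eq_of_forall_mem fun U hU => (hx' U).2 ((hx U).1 hU))
  refine ⟨⟨h, continuous_iff_continuousAt.2 fun x V hV => ?_,
    continuous_iff_continuousAt.2 fun y V hV => ?_⟩⟩
  · change h ⁻¹' V ∈ 𝓝 x
    obtain ⟨U, hxU, hUV⟩ := exists_mem_subset hV
    filter_upwards [(e.symm U).2.1.mem_nhds ((hh x _).2 (by simpa using hxU))] with z hz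
    exact hUV (by simpa using (hh z _).1 hz)
  · change h.symm ⁻¹' V ∈ 𝓝 y
    obtain ⟨U, hyU, hUV⟩ := exists_mem_subset hV
    filter_upwards [(e U).2.1.mem_nhds
      (by simpa using (hh (h.symm y) U).1 hyU)] with z hz
    exact hUV ((hh (h.symm z) U).2 (by simpa using hz))

omit [T2Space S] [LocallyCompactSpace S] in
theorem ProperOpenSigma.nonempty_iff : Nonempty (ProperOpenSigma S) ↔ Nonempty S := by
  refine ⟨fun ⟨U⟩ => ?_, fun ⟨x⟩ => ⟨⟨∅, isOpen_empty, isSigmaCompact_empty, ?_⟩⟩⟩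
  · exact (ne_univ_iff_exists_notMem _).1 U.2.2.2 |>.nonempty
  · exact fun h => notMem_empty x (h ▸ mem_univ x)

theorem ProperOpenSigma.nontrivial_iff : Nontrivial (ProperOpenSigma S) ↔ Nontrivial S := by
  refine ⟨fun h => ?_, fun h => ?_⟩
  · by_contra hS
    rw [not_nontrivial_iff_subsingleton] at hS
    obtain ⟨U, V, hUV⟩ := h
    have hempty : ∀ U : ProperOpenSigma S, U.1 = ∅ := fun U => by
      by_contra hne
      obtain ⟨x, hx⟩ := nonempty_iff_ne_empty.2 hne
      exact U.2.2.2 (eq_univ_of_forall fun y => Subsingleton.elim x y ▸ hx)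
    exact hUV (Subtype.ext ((hempty U).trans (hempty V).symm))
  · obtain ⟨x, -⟩ := exists_pair_ne S
    obtain ⟨U, hxU, -⟩ := exists_mem_subset (Filter.univ_mem (f := 𝓝 x))
    refine ⟨U, ⟨∅, isOpen_empty, isSigmaCompact_empty, fun h => notMem_empty x (h ▸ mem_univ x)⟩,
      fun h => ?_⟩
    rw [h] at hxU
    exact hxU

/-- The reconstruction needs two points, since in a one-point space no proper open set contains the
point. Spaces with at most one point are told apart by whether the ordered set is empty or is just
`{∅}`. -/
theorem ProperOpenSigma.nonempty_homeomorph (e : ProperOpenSigma S ≃o ProperOpenSigma T) :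
    Nonempty (S ≃ₜ T) := by
  have hne : Nonempty S ↔ Nonempty T := by
    rw [← nonempty_iff (S := S), ← nonempty_iff (S := T), e.toEquiv.nonempty_congr]
  have hnt : Nontrivial S ↔ Nontrivial T := by
    rw [← nontrivial_iff (S := S), ← nontrivial_iff (S := T), e.toEquiv.nontrivial_congr]
  by_cases hS : Nontrivial S
  · have := hnt.1 hS
    exact nonempty_homeomorph_of_nontrivial e
  · have hT := mt hnt.2 hS
    rw [not_nontrivial_iff_subsingleton] at hS hT
    rcases isEmpty_or_nonempty S with h | ⟨⟨x⟩⟩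
    · have : IsEmpty T := not_nonempty_iff.1 (mt hne.2 (not_nonempty_iff.2 h))
      exact ⟨⟨Equiv.equivOfIsEmpty S T, continuous_iff_continuousAt.2 isEmptyElim,
        continuous_iff_continuousAt.2 isEmptyElim⟩⟩
    · obtain ⟨y⟩ := hne.1 ⟨x⟩
      exact ⟨⟨⟨fun _ => y, fun _ => x, fun _ => Subsingleton.elim _ _,
        fun _ => Subsingleton.elim _ _⟩, continuous_const, continuous_const⟩⟩

end ProperOpenSigma

/-! ### The structure of `σX` for locally compact paracompact `X` -/

section Structure

variable {X : Type*} [TopologicalSpace X]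

/-- If the trace of `W` on `X` lies in a compact `K`, then by density the interior of `W` lies in
the closed image of `K`. -/
theorem isOpen_range_stoneCechUnit [T35Space X] [LocallyCompactSpace X] :
    IsOpen (range (stoneCechUnit : X → StoneCech X)) := by
  refine isOpen_iff_mem_nhds.2 ?_
  rintro _ ⟨x, rfl⟩
  obtain ⟨K, hK, hxK⟩ := exists_compact_mem_nhds x
  rw [isInducing_stoneCechUnit.nhds_eq_comap, Filter.mem_comap] at hxK
  obtain ⟨W, hW, hWK⟩ := hxK
  have hsub : interior W ⊆ stoneCechUnit '' K := by
    refine (denseRange_stoneCechUnit.open_subset_closure_inter isOpen_interior).trans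
      (closure_minimal ?_ (hK.image continuous_stoneCechUnit).isClosed)
    rintro _ ⟨hz, z, rfl⟩
    exact mem_image_of_mem _ (hWK (interior_subset (s := W) hz))
  exact Filter.mem_of_superset (interior_mem_nhds.2 hW) (hsub.trans (image_subset_range _ _))

/-- The indicator of `B` extends to a continuous two-valued function on `βX`, and the closure of `B`
is the set where it is `true`. -/
theorem IsClopen.closure_stoneCechUnit_image {B : Set X} (hB : IsClopen B) :
    IsClopen (closure (stoneCechUnit '' B)) ∧
      ∀ x, stoneCechUnit x ∈ closure (stoneCechUnit '' B) ↔ x ∈ B := by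
  have hc := (continuous_boolIndicator_iff_isClopen B).2 hB
  have hG := continuous_stoneCechExtend hc
  have hopen : IsOpen (stoneCechExtend hc ⁻¹' {true}) := (isOpen_discrete _).preimage hG
  have hx : ∀ x, stoneCechUnit x ∈ stoneCechExtend hc ⁻¹' {true} ↔ x ∈ B := fun x => by
    rw [mem_preimage, stoneCechExtend_stoneCechUnit, mem_singleton_iff, ← mem_iff_boolIndicator]
  have heq : closure (stoneCechUnit '' B) = stoneCechExtend hc ⁻¹' {true} := by
    refine (closure_minimal ?_ ((isClosed_discrete _).preimage hG)).antisymm ?_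
    · rintro _ ⟨x, hxB, rfl⟩
      exact (hx x).2 hxB
    · refine (denseRange_stoneCechUnit.open_subset_closure_inter hopen).trans (closure_mono ?_)
      rintro _ ⟨hz, z, rfl⟩
      exact mem_image_of_mem _ ((hx z).1 hz)
  rw [heq]
  exact ⟨⟨(isClosed_discrete _).preimage hG, hopen⟩, hx⟩

theorem exists_locallyFinite_isCompact_closure (X : Type*) [TopologicalSpace X] [T2Space X]
    [LocallyCompactSpace X] [ParacompactSpace X] :
    ∃ U : X → Set X, (∀ i, IsOpen (U i)) ∧ ⋃ i, U i = univ ∧ LocallyFinite U ∧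
      ∀ i, IsCompact (closure (U i)) := by
  choose K hK hxK using fun x : X => exists_compact_mem_nhds x
  obtain ⟨U, hUo, hUc, hUl, hUK⟩ := precise_refinement (fun x => interior (K x))
    (fun x => isOpen_interior) (eq_univ_of_forall fun x =>
      mem_iUnion.2 ⟨x, mem_interior_iff_mem_nhds.2 (hxK x)⟩)
  exact ⟨U, hUo, hUc, hUl, fun i => (hK i).closure_of_subset ((hUK i).trans interior_subset)⟩

/-- Iterate the star with respect to a locally finite cover by relatively compact open sets. A
σ-compact set meets only countably many members, so each star is σ-compact. The union of the
iterates contains every member it meets, which makes it both open and closed. -/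
theorem IsSigmaCompact.exists_isClopen_superset [T2Space X] [LocallyCompactSpace X]
    [ParacompactSpace X] {A : Set X} (hA : IsSigmaCompact A) :
    ∃ B, IsClopen B ∧ IsSigmaCompact B ∧ A ⊆ B := by
  obtain ⟨U, hUo, hUc, hUl, hUK⟩ := exists_locallyFinite_isCompact_closure X
  let star : Set X → Set X := fun A => ⋃ i ∈ {i | (U i ∩ A).Nonempty}, closure (U i)
  have hcount : ∀ A, IsSigmaCompact A → {i | (U i ∩ A).Nonempty}.Countable := by
    rintro A ⟨K, hK, rfl⟩
    refine (countable_iUnion fun n => (hUl.finite_nonempty_inter_compact (hK n)).countable).mono ?_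
    rintro i ⟨x, hxi, hx⟩
    obtain ⟨n, hn⟩ := mem_iUnion.1 hx
    exact mem_iUnion.2 ⟨n, x, hxi, hn⟩
  have hstar : ∀ A, IsSigmaCompact A → IsSigmaCompact (star A) := fun A hA =>
    isSigmaCompact_biUnion (hcount A hA) fun i _ => (hUK i).isSigmaCompact
  have hU : ∀ A i, (U i ∩ A).Nonempty → U i ⊆ star A := fun A i hi =>
    subset_closure.trans (subset_biUnion_of_mem (u := fun i => closure (U i)) hi)
  have hit : ∀ n, IsSigmaCompact (star^[n] A) := fun n => by
    induction n with
    | zero => exact hA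
    | succ n ih => rw [Function.iterate_succ_apply']; exact hstar _ ih
  have hcov : ∀ x, ∃ i, x ∈ U i := fun x => mem_iUnion.1 (hUc ▸ mem_univ x)
  have hmem : ∀ i, (U i ∩ ⋃ n, star^[n] A).Nonempty → U i ⊆ ⋃ n, star^[n] A := by
    rintro i ⟨y, hyi, hy⟩
    obtain ⟨n, hn⟩ := mem_iUnion.1 hy
    refine (hU _ i ⟨y, hyi, hn⟩).trans ?_
    rw [← Function.iterate_succ_apply' star]
    exact subset_iUnion (fun n => star^[n] A) (n + 1)
  refine ⟨⋃ n, star^[n] A, ⟨isClosed_of_closure_subset fun x hx => ?_,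
    isOpen_iff_mem_nhds.2 fun x hx => ?_⟩, isSigmaCompact_iUnion _ hit,
    subset_iUnion (fun n => star^[n] A) 0⟩
  · obtain ⟨i, hi⟩ := hcov x
    exact hmem i (mem_closure_iff.1 hx _ (hUo i) hi) hi
  · obtain ⟨i, hi⟩ := hcov x
    exact Filter.mem_of_superset ((hUo i).mem_nhds hi) (hmem i ⟨x, hi, hx⟩)

/-- If infinitely many members of a locally finite cover met `Z`, points of `Z` chosen from
countably many of them would lie in a compact set meeting infinitely many members. So `Z` is covered
by finitely many relatively compact sets. -/
theorem IsClosed.isCompact_of_countable_subset [T2Space X] [LocallyCompactSpace X]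
    [ParacompactSpace X] {Z : Set X} (hZ : IsClosed Z)
    (h : ∀ D ⊆ Z, D.Countable → ∃ K, IsCompact K ∧ D ⊆ K) : IsCompact Z := by
  obtain ⟨U, hUo, hUc, hUl, hUK⟩ := exists_locallyFinite_isCompact_closure X
  have hfin : {i | (U i ∩ Z).Nonempty}.Finite := by
    by_contra hinf
    obtain ⟨J, hJ, hJinf, hJc⟩ : ∃ J ⊆ {i | (U i ∩ Z).Nonempty}, J.Infinite ∧ J.Countable := by
      have := Set.Infinite.to_subtype hinf
      let f := Infinite.natEmbedding {i | (U i ∩ Z).Nonempty}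
      exact ⟨_, Subtype.coe_image_subset _ (range f),
        (infinite_range_of_injective f.injective).image Subtype.val_injective.injOn,
        (countable_range f).image _⟩
    have : Nonempty X := ⟨hJinf.nonempty.choose⟩
    have hJ' : ∀ i ∈ J, ∃ x, x ∈ U i ∩ Z := fun i hi => hJ hi
    choose! z hz using hJ'
    obtain ⟨K, hK, hDK⟩ := h (z '' J) (image_subset_iff.2 fun i hi => (hz i hi).2) (hJc.image z)
    exact hJinf ((hUl.finite_nonempty_inter_compact hK).subset fun i hi =>
      ⟨z i, (hz i hi).1, hDK (mem_image_of_mem z hi)⟩)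
  refine (hfin.isCompact_biUnion fun i _ => hUK i).of_isClosed_subset hZ fun x hx => ?_
  obtain ⟨i, hi⟩ := mem_iUnion.1 (hUc ▸ mem_univ x)
  exact mem_biUnion (show i ∈ {i | (U i ∩ Z).Nonempty} from ⟨x, hi, hx⟩) (subset_closure hi)

theorem IsSigmaCompact.closure_subset_sigmaExt {A : Set X} (hA : IsSigmaCompact A) :
    closure (stoneCechUnit '' A) ⊆ sigmaExt X :=
  subset_biUnion_of_mem (u := fun A : Set X => closure (stoneCechUnit '' A)) hA

theorem range_stoneCechUnit_subset_sigmaExt :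
    range (stoneCechUnit : X → StoneCech X) ⊆ sigmaExt X := by
  rintro _ ⟨x, rfl⟩
  exact (isCompact_singleton (x := x)).isSigmaCompact.closure_subset_sigmaExt
    (subset_closure (mem_image_of_mem _ rfl))

theorem IsSigmaCompact.union {A B : Set X} (hA : IsSigmaCompact A) (hB : IsSigmaCompact B) :
    IsSigmaCompact (A ∪ B) := by
  rw [union_eq_iUnion]
  exact isSigmaCompact_iUnion _ fun b => by cases b <;> assumption

variable [T2Space X] [LocallyCompactSpace X] [ParacompactSpace X]

theorem mem_sigmaExt_iff {q : StoneCech X} : q ∈ sigmaExt X ↔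
    ∃ B : Set X, IsClopen B ∧ IsSigmaCompact B ∧ q ∈ closure (stoneCechUnit '' B) := by
  constructor
  · intro hq
    obtain ⟨A, hA, hqA⟩ := mem_iUnion₂.1 hq
    obtain ⟨B, hB, hBs, hAB⟩ := IsSigmaCompact.exists_isClopen_superset hA
    exact ⟨B, hB, hBs, closure_mono (image_mono hAB) hqA⟩
  · rintro ⟨B, -, hB, hq⟩
    exact hB.closure_subset_sigmaExt hq

theorem isOpen_sigmaExt : IsOpen (sigmaExt X) := by
  refine isOpen_iff_mem_nhds.2 fun q hq => ?_
  obtain ⟨B, hB, hBs, hqB⟩ := mem_sigmaExt_iff.1 hq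
  exact Filter.mem_of_superset (hB.closure_stoneCechUnit_image.1.2.mem_nhds hqB)
    hBs.closure_subset_sigmaExt

theorem IsCompact.exists_isClopen_of_subset_sigmaExt {K : Set (StoneCech X)} (hK : IsCompact K)
    (h : K ⊆ sigmaExt X) :
    ∃ B : Set X, IsClopen B ∧ IsSigmaCompact B ∧ K ⊆ closure (stoneCechUnit '' B) := by
  let ι := {B : Set X // IsClopen B ∧ IsSigmaCompact B}
  have : Nonempty ι := ⟨⟨∅, isClopen_empty, isSigmaCompact_empty⟩⟩
  obtain ⟨B, hB⟩ := hK.elim_directed_cover (fun B : ι => closure (stoneCechUnit '' B.1))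
    (fun B => B.2.1.closure_stoneCechUnit_image.1.2)
    (fun q hq => by
      obtain ⟨B, hB, hBs, hqB⟩ := mem_sigmaExt_iff.1 (h hq)
      exact mem_iUnion.2 ⟨⟨B, hB, hBs⟩, hqB⟩)
    (fun B C => ⟨⟨B.1 ∪ C.1, B.2.1.union C.2.1, B.2.2.union C.2.2⟩,
      closure_mono (image_mono subset_union_left), closure_mono (image_mono subset_union_right)⟩)
  exact ⟨B.1, B.2.1, B.2.2, hB⟩

instance : LocallyCompactSpace (sigmaRemainder X) :=
  (isOpen_sigmaExt.isLocallyClosed.inter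
    isOpen_range_stoneCechUnit.isClosed_compl.isLocallyClosed).locallyCompactSpace

/-- The remainder `σX \ X` then lies in the closure of one clopen σ-compact `B`. A countable subset
of `X \ B` has its closure in `σX` but off the closure of `B`, hence inside `X`. So `X \ B` is
compact and adds no points to `βX \ X`. -/
theorem compl_range_subset_sigmaExt_of_isSigmaCompact (h : IsSigmaCompact (sigmaRemainder X)) :
    (range (stoneCechUnit : X → StoneCech X))ᶜ ⊆ sigmaExt X := by
  obtain ⟨K, hK, hKS⟩ := h
  choose A hA hAs hKA using fun n => (hK n).exists_isClopen_of_subset_sigmaExt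
    ((subset_iUnion K n).trans (hKS.subset.trans sdiff_subset))
  obtain ⟨B, hB, hBs, hAB⟩ := (isSigmaCompact_iUnion A hAs).exists_isClopen_superset
  have hSB : sigmaRemainder X ⊆ closure (stoneCechUnit '' B) := by
    rw [← hKS]
    exact iUnion_subset fun n => (hKA n).trans
      (closure_mono (image_mono ((subset_iUnion A n).trans hAB)))
  have hcl := hB.closure_stoneCechUnit_image
  have hBc : IsCompact Bᶜ := by
    refine hB.compl.1.isCompact_of_countable_subset fun D hD hDc => ?_
    have hDs : IsSigmaCompact D := by
      rw [← biUnion_of_singleton D]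
      exact isSigmaCompact_biUnion hDc fun x _ => isCompact_singleton.isSigmaCompact
    have hdisj : closure (stoneCechUnit '' D) ⊆ (closure (stoneCechUnit '' B))ᶜ := by
      refine closure_minimal ?_ hcl.1.compl.1
      rintro _ ⟨x, hx, rfl⟩ hxB
      exact hD hx ((hcl.2 x).1 hxB)
    have hr : closure (stoneCechUnit '' D) ⊆ range stoneCechUnit := fun q hq => by
      by_contra hqr
      exact hdisj hq (hSB ⟨hDs.closure_subset_sigmaExt hq, hqr⟩)
    refine ⟨stoneCechUnit ⁻¹' closure (stoneCechUnit '' D), ?_, fun x hx =>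
      subset_closure (mem_image_of_mem _ hx)⟩
    rw [isInducing_stoneCechUnit.isCompact_iff, image_preimage_eq_inter_range,
      inter_eq_left.2 hr]
    exact isClosed_closure.isCompact
  intro q hq
  have hq' : q ∈ closure (stoneCechUnit '' (B ∪ Bᶜ)) := by
    rw [union_compl_self, image_univ]
    exact denseRange_stoneCechUnit q
  rw [image_union, closure_union,
    (hBc.image continuous_stoneCechUnit).isClosed.closure_eq] at hq'
  rcases hq' with hq' | ⟨x, -, rfl⟩
  · exact hBs.closure_subset_sigmaExt hq'
  · exact absurd (mem_range_self x) hq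

/-- Inside the clopen closure of a σ-compact clopen `B`, the remainder is obtained by removing the
countably many compact pieces of `B`, so it is `G_δ` there. -/
theorem isGδ_image_val_of_isCompact {K : Set (sigmaRemainder X)} (hK : IsCompact K)
    (hKg : IsGδ K) : IsGδ (Subtype.val '' K : Set (StoneCech X)) := by
  obtain ⟨O, hO, rfl⟩ := hKg.eq_iInter_nat
  choose W hW hWO using fun n => isOpen_induced_iff.1 (hO n)
  obtain ⟨B, hB, ⟨L, hL, hLB⟩, hKB⟩ :=
    (hK.image continuous_subtype_val).exists_isClopen_of_subset_sigmaExt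
      (by rintro _ ⟨q, -, rfl⟩; exact q.2.1)
  have hcl := hB.closure_stoneCechUnit_image
  have heq : (Subtype.val '' ⋂ n, O n : Set (StoneCech X)) =
      closure (stoneCechUnit '' B) ∩ (⋂ n, (stoneCechUnit '' L n)ᶜ) ∩ ⋂ n, W n := by
    ext q
    constructor
    · rintro ⟨q, hq, rfl⟩
      refine ⟨⟨hKB (mem_image_of_mem _ hq), mem_iInter.2 fun n => ?_⟩, mem_iInter.2 fun n => ?_⟩
      · exact fun h => q.2.2 (image_subset_range _ _ h)
      · have := mem_iInter.1 hq n
        rwa [← hWO n] at this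
    · rintro ⟨⟨hqB, hqL⟩, hqW⟩
      have hqS : q ∈ sigmaRemainder X := by
        refine ⟨mem_sigmaExt_iff.2 ⟨B, hB, ⟨L, hL, hLB⟩, hqB⟩, ?_⟩
        rintro ⟨x, rfl⟩
        have hx := (hcl.2 x).1 hqB
        rw [← hLB] at hx
        obtain ⟨n, hn⟩ := mem_iUnion.1 hx
        exact mem_iInter.1 hqL n (mem_image_of_mem _ hn)
      refine ⟨⟨q, hqS⟩, mem_iInter.2 fun n => ?_, rfl⟩
      rw [← hWO n]
      exact mem_iInter.1 hqW n
  rw [heq]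
  exact (hcl.1.2.isGδ.inter (.iInter_of_isOpen fun n =>
    ((hL n).image continuous_stoneCechUnit).isClosed.isOpen_compl)).inter (.iInter_of_isOpen hW)

end Structure

theorem IsLindelof.isSigmaCompact_of_isClosed {X : Type*} [TopologicalSpace X]
    [WeaklyLocallyCompactSpace X] {A : Set X} (hA : IsLindelof A) (hc : IsClosed A) :
    IsSigmaCompact A := by
  choose K hK hxK using fun x : X => exists_compact_mem_nhds x
  obtain ⟨t, htc, -, hAt⟩ := hA.elim_nhds_subcover K fun x _ => hxK x
  exact (isSigmaCompact_biUnion htc fun x _ => (hK x).isSigmaCompact).of_isClosed_subset hc hAt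

/-- `C` is the fibre `f = 1` of a continuous real function, and `f` is a closed map, so
neighbourhoods of `C` are pulled back from neighbourhoods of `1`. -/
theorem IsGδ.isCountablyGenerated_nhdsSet {Z : Type*} [TopologicalSpace Z] [CompactSpace Z]
    [T2Space Z] {C : Set Z} (hC : IsClosed C) (hg : IsGδ C) : (𝓝ˢ C).IsCountablyGenerated := by
  obtain ⟨f, rfl, -⟩ := exists_continuous_one_zero_of_isCompact_of_isGδ hC.isCompact hg
    isClosed_empty (disjoint_empty _)
  rw [← f.continuous.isClosedMap.comap_nhds_eq f.continuous]
  infer_instance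

/-! ### The fibre over the added point, and what it says about the extension -/

namespace OnePointExtension

variable {X : Type u} [TopologicalSpace X] (Y Y₁ Y₂ : OnePointExtension X)

theorem emb_ne_pt (x : X) : Y.emb x ≠ Y.pt := fun h =>
  (Y.compl_range.symm.subset rfl : Y.pt ∈ (range Y.emb)ᶜ) ⟨x, h⟩

theorem eq_pt_or_exists_emb_eq (y : Y.carrier) : y = Y.pt ∨ ∃ x, Y.emb x = y := by
  by_cases h : y ∈ range Y.emb
  · exact Or.inr h
  · exact Or.inl (Y.compl_range.subset h)

theorem isOpenEmbedding_emb : IsOpenEmbedding Y.emb :=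
  ⟨Y.isEmbedding, by
    rw [← compl_compl (range Y.emb), Y.compl_range]; exact isClosed_singleton.isOpen_compl⟩

theorem diff_pt (U : Set Y.carrier) : U \ {Y.pt} = Y.emb '' (Y.emb ⁻¹' U) := by
  rw [image_preimage_eq_inter_range, ← Y.compl_range, sdiff_compl]

/-- The canonical map `βX → βY`. -/
noncomputable def stoneCechMap : StoneCech X → StoneCech Y.carrier :=
  stoneCechExtend (continuous_stoneCechUnit.comp Y.isEmbedding.continuous)

theorem continuous_stoneCechMap : Continuous Y.stoneCechMap := continuous_stoneCechExtend _

theorem stoneCechMap_stoneCechUnit (x : X) :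
    Y.stoneCechMap (stoneCechUnit x) = stoneCechUnit (Y.emb x) :=
  stoneCechExtend_stoneCechUnit _ _

theorem surjective_stoneCechMap : Function.Surjective Y.stoneCechMap := by
  rw [← range_eq_univ, ← (isCompact_range Y.continuous_stoneCechMap).isClosed.closure_eq]
  refine ((denseRange_stoneCechUnit.comp Y.denseRange continuous_stoneCechUnit).mono ?_).closure_eq
  rintro _ ⟨x, rfl⟩
  exact ⟨_, Y.stoneCechMap_stoneCechUnit x⟩

/-- The set of points of `βX` that are mapped to the added point of `Y`. -/
def fiber : Set (StoneCech X) := Y.stoneCechMap ⁻¹' {stoneCechUnit Y.pt}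

theorem mem_fiber {q : StoneCech X} : q ∈ Y.fiber ↔ Y.stoneCechMap q = stoneCechUnit Y.pt := Iff.rfl

theorem isClosed_fiber : IsClosed Y.fiber := isClosed_singleton.preimage Y.continuous_stoneCechMap

theorem nonempty_fiber : Y.fiber.Nonempty := Y.surjective_stoneCechMap _

theorem fiber_subset : Y.fiber ⊆ (range stoneCechUnit)ᶜ := by
  rintro _ hq ⟨x, rfl⟩
  rw [mem_fiber, stoneCechMap_stoneCechUnit] at hq
  exact Y.emb_ne_pt x (injective_stoneCechUnit_of_t35Space hq)

/-- Since `βX → βY` is a closed map, the neighbourhoods of the fibre are the pullbacks of those of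
`p` in `βY`. -/
theorem comap_emb_nhds_pt :
    Filter.comap Y.emb (𝓝 Y.pt) = Filter.comap stoneCechUnit (𝓝ˢ Y.fiber) := by
  rw [isInducing_stoneCechUnit.nhds_eq_comap, Filter.comap_comap, fiber,
    ← Y.continuous_stoneCechMap.isClosedMap.comap_nhds_eq Y.continuous_stoneCechMap,
    Filter.comap_comap]
  congr 1
  exact funext fun x => (Y.stoneCechMap_stoneCechUnit x).symm

theorem nhds_pt : 𝓝 Y.pt =
    pure Y.pt ⊔ Filter.map Y.emb (Filter.comap stoneCechUnit (𝓝ˢ Y.fiber)) := by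
  rw [← comap_emb_nhds_pt]
  refine le_antisymm (fun U hU => ?_) (sup_le (pure_le_nhds _) Filter.map_comap_le)
  obtain ⟨hp, V, hV, hVU⟩ := hU
  filter_upwards [hV] with y hy
  rcases Y.eq_pt_or_exists_emb_eq y with rfl | ⟨x, rfl⟩
  · exact hp
  · exact hVU hy

theorem mem_nhds_pt_iff {U : Set Y.carrier} : U ∈ 𝓝 Y.pt ↔
    Y.pt ∈ U ∧ ∃ V, IsOpen V ∧ Y.fiber ⊆ V ∧ stoneCechUnit ⁻¹' V ⊆ Y.emb ⁻¹' U := by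
  rw [nhds_pt, Filter.mem_sup, Filter.mem_pure, Filter.mem_map, Filter.mem_comap]
  refine and_congr_right fun _ => ⟨?_, ?_⟩
  · rintro ⟨V, hV, hVU⟩
    obtain ⟨W, hW, hCW, hWV⟩ := mem_nhdsSet_iff_exists.1 hV
    exact ⟨W, hW, hCW, (preimage_mono hWV).trans hVU⟩
  · rintro ⟨V, hV, hCV, hVU⟩
    exact ⟨V, hV.mem_nhdsSet.2 hCV, hVU⟩

variable {Y₁ Y₂} in
-- If `f` sent `p` to a point `x` of `X`, the trace on `X` of the neighbourhoods of `p` would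
-- converge in `Y₁` both to `p` and to `x`.
theorem Dominates.map_pt {f : Y₁.carrier → Y₂.carrier} (hf : Continuous f)
    (hfx : ∀ x, f (Y₁.emb x) = Y₂.emb x) : f Y₁.pt = Y₂.pt := by
  rcases Y₂.eq_pt_or_exists_emb_eq (f Y₁.pt) with h | ⟨x, hx⟩
  · exact h
  · have hl := (⟨Y₁.isEmbedding.isInducing, Y₁.denseRange⟩ :
      IsDenseInducing Y₁.emb).comap_nhds_neBot Y₁.pt
    have h₁ : Filter.Tendsto Y₁.emb (Filter.comap Y₁.emb (𝓝 Y₁.pt)) (𝓝 Y₁.pt) :=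
      Filter.tendsto_comap
    have h₂ : Filter.Tendsto id (Filter.comap Y₁.emb (𝓝 Y₁.pt)) (𝓝 x) := by
      rw [Y₂.isEmbedding.isInducing.nhds_eq_comap, Filter.tendsto_comap_iff, hx]
      exact ((hf.tendsto _).comp h₁).congr hfx
    exact absurd (tendsto_nhds_unique ((Y₁.isEmbedding.continuous.tendsto x).comp h₂) h₁)
      (Y₁.emb_ne_pt x)

theorem dominates_iff_fiber_subset : Y₁.Dominates Y₂ ↔ Y₁.fiber ⊆ Y₂.fiber := by
  constructor
  · rintro ⟨f, hf, hfx⟩ q hq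
    have heq : stoneCechExtend (continuous_stoneCechUnit.comp hf) ∘ Y₁.stoneCechMap =
        Y₂.stoneCechMap :=
      stoneCech_hom_ext ((continuous_stoneCechExtend _).comp Y₁.continuous_stoneCechMap)
        Y₂.continuous_stoneCechMap (funext fun x => by simp [stoneCechMap_stoneCechUnit, hfx])
    rw [mem_fiber, ← heq, Function.comp_apply, Y₁.mem_fiber.1 hq, stoneCechExtend_stoneCechUnit,
      Function.comp_apply, Dominates.map_pt hf hfx]
  · intro h
    classical
    let f : Y₁.carrier → Y₂.carrier := fun y =>
      if hy : ∃ x, Y₁.emb x = y then Y₂.emb hy.choose else Y₂.pt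
    have hfx : ∀ x, f (Y₁.emb x) = Y₂.emb x := fun x => by
      have hy : ∃ x', Y₁.emb x' = Y₁.emb x := ⟨x, rfl⟩
      simp only [f, dif_pos hy]
      exact congrArg _ (Y₁.isEmbedding.injective hy.choose_spec)
    have hfp : f Y₁.pt = Y₂.pt := dif_neg fun ⟨x, hx⟩ => Y₁.emb_ne_pt x hx
    refine ⟨f, continuous_iff_continuousAt.2 fun y => ?_, hfx⟩
    rcases Y₁.eq_pt_or_exists_emb_eq y with rfl | ⟨x, rfl⟩
    · rw [ContinuousAt, hfp, nhds_pt, nhds_pt, Filter.tendsto_sup, Filter.tendsto_pure_left,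
        Filter.tendsto_map'_iff]
      refine ⟨fun s hs => by rw [hfp]; exact hs.1, Filter.Tendsto.mono_right ?_ le_sup_right⟩
      rw [show f ∘ Y₁.emb = Y₂.emb from funext hfx]
      exact Filter.tendsto_map.mono_left (Filter.comap_mono (nhdsSet_mono h))
    · rw [Y₁.isOpenEmbedding_emb.continuousAt_iff.symm,
        show f ∘ Y₁.emb = Y₂.emb from funext hfx]
      exact Y₂.isEmbedding.continuous.continuousAt

theorem isCountablyGenerated_nhds_pt_iff :
    (𝓝 Y.pt).IsCountablyGenerated ↔ IsGδ Y.fiber := by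
  constructor
  · intro h
    obtain ⟨V, hV⟩ := (𝓝 Y.pt).exists_antitone_basis
    have hW : ∀ n, ∃ W, IsOpen W ∧ stoneCechUnit Y.pt ∈ W ∧ stoneCechUnit ⁻¹' W ⊆ V n := fun n => by
      have := hV.mem n
      rw [isInducing_stoneCechUnit.nhds_eq_comap, Filter.mem_comap] at this
      obtain ⟨W, hW, hWV⟩ := this
      obtain ⟨W', hW', hWo, hp⟩ := mem_nhds_iff.1 hW
      exact ⟨W', hWo, hp, (preimage_mono hW').trans hWV⟩
    choose W hWo hpW hWV using hW
    have heq : Y.fiber = ⋂ n, Y.stoneCechMap ⁻¹' W n := by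
      refine Subset.antisymm (fun q hq => mem_iInter.2 fun n => ?_) fun q hq => ?_
      · rw [mem_preimage, Y.mem_fiber.1 hq]
        exact hpW n
      -- Points of `Y` near the image of `q` and inside `W n` lie in `V n`, hence in `N` for large
      -- `n`, although they also lie in the disjoint set `M`.
      · by_contra hne
        obtain ⟨M, N, hM, hN, hqM, hpN, hMN⟩ := t2_separation hne
        obtain ⟨n, -, hn⟩ := hV.1.mem_iff.1 (continuous_stoneCechUnit.continuousAt.preimage_mem_nhds
          (hN.mem_nhds hpN))
        obtain ⟨y, hy⟩ := denseRange_stoneCechUnit.exists_mem_open (hM.inter (hWo n))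
          ⟨_, hqM, mem_iInter.1 hq n⟩
        exact hMN.le_bot ⟨hy.1, hn (hWV n hy.2)⟩
    rw [heq]
    exact .iInter_of_isOpen fun n => (hWo n).preimage Y.continuous_stoneCechMap
  · intro h
    have := h.isCountablyGenerated_nhdsSet Y.isClosed_fiber
    rw [nhds_pt]
    infer_instance

/-- `Y` is `G_δ` in `βY` exactly when `βY \ Y` is σ-compact. The full preimage of `βY \ Y` in `βX`
is `(βX \ X)` minus the fibre, so σ-compactness passes both ways along the surjection. -/
theorem isGδ_range_stoneCechUnit_iff [T35Space X] [LocallyCompactSpace X] :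
    IsGδ (range (stoneCechUnit : Y.carrier → StoneCech Y.carrier)) ↔
      IsSigmaCompact ((range stoneCechUnit)ᶜ \ Y.fiber) := by
  -- Over a point of `X` the map `βX → βY` has a single preimage: the trace on `X` of the
  -- neighbourhoods of `q` converges both to `q` and to `x`.
  have hinj : ∀ q x, Y.stoneCechMap q = stoneCechUnit (Y.emb x) → q = stoneCechUnit x := by
    intro q x hq
    have hl := isDenseInducing_stoneCechUnit.comap_nhds_neBot q
    have h₁ : Filter.Tendsto (stoneCechUnit : X → _) (Filter.comap stoneCechUnit (𝓝 q)) (𝓝 q) :=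
      Filter.tendsto_comap
    have h₂ : Filter.Tendsto id (Filter.comap stoneCechUnit (𝓝 q)) (𝓝 x) := by
      rw [(isEmbedding_stoneCechUnit.comp Y.isEmbedding).isInducing.nhds_eq_comap,
        Filter.tendsto_comap_iff]
      have := (Y.continuous_stoneCechMap.tendsto q).comp h₁
      rw [hq] at this
      exact this.congr fun z => Y.stoneCechMap_stoneCechUnit z
    exact tendsto_nhds_unique h₁ ((continuous_stoneCechUnit.tendsto x).comp h₂)
  constructor
  · intro h
    obtain ⟨G, hG, hGeq⟩ := h.eq_iInter_nat
    refine ⟨fun n => (range stoneCechUnit)ᶜ ∩ (Y.stoneCechMap ⁻¹' G n)ᶜ, fun n =>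
      (isOpen_range_stoneCechUnit.isClosed_compl.inter
        ((hG n).preimage Y.continuous_stoneCechMap).isClosed_compl).isCompact, ?_⟩
    rw [← inter_iUnion, ← compl_iInter, ← preimage_iInter, ← hGeq, sdiff_eq]
    ext q
    refine and_congr_right fun hq => not_congr ⟨?_, fun h => ⟨_, h.symm⟩⟩
    rintro ⟨y, hy⟩
    rcases Y.eq_pt_or_exists_emb_eq y with rfl | ⟨x, rfl⟩
    · exact hy.symm
    · exact absurd ⟨x, (hinj q x hy.symm).symm⟩ hq
  · rintro ⟨K, hK, hKeq⟩
    have heq : range (stoneCechUnit : Y.carrier → _) = ⋂ n, (Y.stoneCechMap '' K n)ᶜ := by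
      rw [← compl_iUnion, ← image_iUnion, hKeq]
      ext z
      constructor
      · rintro ⟨y, rfl⟩ ⟨q, ⟨hqr, hqf⟩, hq⟩
        rcases Y.eq_pt_or_exists_emb_eq y with rfl | ⟨x, rfl⟩
        · exact hqf hq
        · exact hqr ⟨x, (hinj q x hq).symm⟩
      · intro hz
        by_contra hzr
        obtain ⟨q, rfl⟩ := Y.surjective_stoneCechMap z
        refine hz ⟨q, ⟨?_, fun h => hzr ⟨_, h.symm⟩⟩, rfl⟩
        rintro ⟨x, rfl⟩
        exact hzr ⟨_, (Y.stoneCechMap_stoneCechUnit x).symm⟩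
    rw [heq]
    exact .iInter_of_isOpen fun n =>
      ((hK n).image Y.continuous_stoneCechMap).isClosed.isOpen_compl

section Paracompact

variable [T2Space X] [LocallyCompactSpace X] [ParacompactSpace X]

theorem exists_isSigmaCompact_diff_pt_iff :
    (∃ U ∈ 𝓝 Y.pt, IsSigmaCompact (U \ {Y.pt})) ↔ Y.fiber ⊆ sigmaExt X := by
  constructor
  · rintro ⟨U, hU, hs⟩ q hq
    rw [diff_pt, ← Y.isEmbedding.isSigmaCompact_iff] at hs
    refine hs.closure_subset_sigmaExt (mem_closure_iff_nhds.2 fun N hN => ?_)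
    obtain ⟨-, V, hV, hCV, hVU⟩ := Y.mem_nhds_pt_iff.1 hU
    obtain ⟨x, hx⟩ := denseRange_stoneCechUnit.exists_mem_open (isOpen_interior.inter hV)
      ⟨q, mem_interior_iff_mem_nhds.2 hN, hCV hq⟩
    exact ⟨_, interior_subset hx.1, mem_image_of_mem _ (hVU hx.2)⟩
  · intro h
    obtain ⟨B, hB, hBs, hCB⟩ := Y.isClosed_fiber.isCompact.exists_isClopen_of_subset_sigmaExt h
    have hcl := hB.closure_stoneCechUnit_image
    refine ⟨insert Y.pt (Y.emb '' B), Y.mem_nhds_pt_iff.2 ⟨mem_insert _ _, _, hcl.1.2, hCB,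
      fun x hx => mem_insert_of_mem _ (mem_image_of_mem _ ((hcl.2 x).1 hx))⟩, ?_⟩
    rw [insert_sdiff_self_of_notMem (by rintro ⟨x, -, hx⟩; exact Y.emb_ne_pt x hx)]
    exact hBs.image Y.isEmbedding.continuous

/-- For a Lindelöf `Y`, a point off the fibre is a limit of a closed subset of `X` that remains
closed in `Y`; it is Lindelöf, hence σ-compact by local compactness. Conversely, the complement of a
neighbourhood of `p` is closed and lies in a σ-compact clopen set, so it is Lindelöf. -/
theorem lindelofSpace_iff : LindelofSpace Y.carrier ↔ (sigmaExt X)ᶜ ⊆ Y.fiber := by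
  constructor
  · intro h q hq
    by_contra hqf
    obtain ⟨M, N, hM, hN, hqM, hpN, hMN⟩ := t2_separation hqf
    have hA : IsSigmaCompact (Y.emb ⁻¹' (stoneCechUnit ⁻¹' closure M)) := by
      have hcl : IsClosed (stoneCechUnit ⁻¹' closure M : Set Y.carrier) :=
        isClosed_closure.preimage continuous_stoneCechUnit
      have hp : Y.pt ∉ (stoneCechUnit ⁻¹' closure M : Set Y.carrier) := fun hp =>
        (hMN.closure_left hN).le_bot ⟨hp, hpN⟩
      refine IsLindelof.isSigmaCompact_of_isClosed ?_ (hcl.preimage Y.isEmbedding.continuous)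
      rw [Y.isEmbedding.isLindelof_iff, ← diff_pt, sdiff_singleton_eq_self hp]
      exact hcl.isLindelof
    refine hq (hA.closure_subset_sigmaExt (mem_closure_iff_nhds.2 fun L hL => ?_))
    obtain ⟨x, hx⟩ := denseRange_stoneCechUnit.exists_mem_open
      (isOpen_interior.inter (hM.preimage Y.continuous_stoneCechMap))
      ⟨q, mem_interior_iff_mem_nhds.2 hL, hqM⟩
    refine ⟨_, interior_subset hx.1, mem_image_of_mem _ (subset_closure ?_)⟩
    rw [← stoneCechMap_stoneCechUnit]
    exact hx.2
  · intro h
    have hL : ∀ U : Set Y.carrier, IsOpen U → Y.pt ∈ U → IsLindelof Uᶜ := by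
      intro U hU hp
      obtain ⟨-, V, hV, hCV, hVU⟩ := Y.mem_nhds_pt_iff.1 (hU.mem_nhds hp)
      obtain ⟨B, hB, hBs, hVB⟩ := hV.isClosed_compl.isCompact.exists_isClopen_of_subset_sigmaExt
        (compl_subset_comm.1 (h.trans hCV))
      refine ((hBs.image Y.isEmbedding.continuous).of_isClosed_subset hU.isClosed_compl
        fun y hy => ?_).isLindelof
      rcases Y.eq_pt_or_exists_emb_eq y with rfl | ⟨x, rfl⟩
      · exact absurd hp hy
      · exact mem_image_of_mem _ ((hB.closure_stoneCechUnit_image.2 x).1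
          (hVB fun hx => hy (hVU hx)))
    refine ⟨isLindelof_of_countable_subcover fun {ι} U hU hcov => ?_⟩
    obtain ⟨i, hi⟩ := mem_iUnion.1 (hcov (mem_univ Y.pt))
    obtain ⟨t, ht, htU⟩ := (hL (U i) (hU i) hi).elim_countable_subcover U hU
      ((subset_univ _).trans hcov)
    refine ⟨insert i t, ht.insert i, fun y _ => ?_⟩
    by_cases hy : y ∈ U i
    · exact mem_biUnion (mem_insert i t) hy
    · exact biUnion_subset_biUnion_left (subset_insert i t) (htU hy)

end Paracompact

end OnePointExtension

/-! ### Realising every nonempty closed subset of `βX \ X` as a fibre -/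

namespace OnePointExtension

variable {X : Type u} [TopologicalSpace X]

section Collapse

variable (C : Set (StoneCech X))

/-- The continuous functions `βX → [0, 1]` that are equal to one on `C`. -/
def FunctionsOneOn : Type u := {f : C(StoneCech X, unitInterval) // EqOn f 1 C}

/-- Evaluation of the functions in `FunctionsOneOn C` on `X ∪ {p}`, where `C` is collapsed to
`p`. -/
def collapseEval : Option X → FunctionsOneOn C → unitInterval
  | none => fun _ => 1
  | some x => fun f => f.1 (stoneCechUnit x)

variable {C}

theorem exists_functionsOneOn (hC : IsClosed C) {q : StoneCech X} (hq : q ∉ C)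
    {W : Set (StoneCech X)} (hW : IsOpen W) (hqW : q ∈ W) :
    ∃ f : FunctionsOneOn C, f.1 q = 0 ∧ EqOn f.1 1 Wᶜ := by
  obtain ⟨f, hf, hfq, hf1⟩ := CompletelyRegularSpace.completely_regular q (C ∪ Wᶜ)
    (hC.union hW.isClosed_compl) (by simp [hq, hqW])
  exact ⟨⟨⟨f, hf⟩, hf1.mono subset_union_left⟩, hfq, hf1.mono subset_union_right⟩

theorem collapseEval_injective [T35Space X] (hC : IsClosed C)
    (hCX : C ⊆ (range stoneCechUnit)ᶜ) : Function.Injective (collapseEval C) := by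
  have hmem : ∀ x : X, stoneCechUnit x ∉ C := fun x hx => hCX hx ⟨x, rfl⟩
  have h₁ : ∀ x : X, collapseEval C (some x) ≠ collapseEval C none := fun x h => by
    obtain ⟨f, hf, -⟩ := exists_functionsOneOn hC (hmem x) isOpen_univ (mem_univ _)
    have := congrFun h f
    simp [collapseEval, hf] at this
  rintro (_ | x) (_ | y) h
  · rfl
  · exact absurd h.symm (h₁ y)
  · exact absurd h (h₁ x)
  · by_contra hne
    have hxy : (stoneCechUnit x : StoneCech X) ∈ ({stoneCechUnit y}ᶜ : Set _) := fun h =>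
      hne (congrArg some (injective_stoneCechUnit_of_t35Space h))
    obtain ⟨f, hf, hf1⟩ := exists_functionsOneOn hC (hmem x) isOpen_compl_singleton hxy
    have := congrFun h f
    simp only [collapseEval, hf] at this
    rw [hf1 (by simp : stoneCechUnit y ∈ ({stoneCechUnit y}ᶜᶜ : Set _))] at this
    exact zero_ne_one this

theorem tendsto_some_of_mem {q : StoneCech X} (hq : q ∈ C) :
    Filter.Tendsto (some : X → Option X) (Filter.comap stoneCechUnit (𝓝 q))
      (@nhds _ (.induced (collapseEval C) inferInstance) none) := by
  rw [nhds_induced, Filter.tendsto_comap_iff, tendsto_pi_nhds]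
  intro f
  have := (f.1.continuous.tendsto q).comp
    (Filter.tendsto_comap : Filter.Tendsto (stoneCechUnit : X → _) _ (𝓝 q))
  rw [f.2 hq] at this
  exact this

theorem isEmbedding_some [T35Space X] (hC : IsClosed C) (hCX : C ⊆ (range stoneCechUnit)ᶜ) :
    @IsEmbedding _ _ _ (.induced (collapseEval C) inferInstance) (some : X → Option X) := by
  let _ : TopologicalSpace (Option X) := .induced (collapseEval C) inferInstance
  have hcont : Continuous (some : X → Option X) := continuous_induced_rng.2
    (continuous_pi fun f => f.1.continuous.comp continuous_stoneCechUnit)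
  refine ⟨isInducing_iff_nhds.2 fun x => le_antisymm (hcont.tendsto x).le_comap fun V hV => ?_,
    Option.some_injective X⟩
  rw [isInducing_stoneCechUnit.nhds_eq_comap, Filter.mem_comap] at hV
  obtain ⟨W, hW, hWV⟩ := hV
  obtain ⟨f, hf, hf1⟩ := exists_functionsOneOn hC (fun hx => hCX hx ⟨x, rfl⟩) isOpen_interior
    (mem_interior_iff_mem_nhds.2 hW)
  have hfc : Continuous fun y => collapseEval C y f :=
    (continuous_apply f).comp continuous_induced_dom
  refine ⟨{y | collapseEval C y f < 1}, (isOpen_Iio.preimage hfc).mem_nhds ?_, fun y hy => hWV ?_⟩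
  · simp [collapseEval, hf]
  · by_contra hyW
    have : f.1 (stoneCechUnit y) = 1 := hf1 fun h => hyW (interior_subset (s := W) h)
    simp [collapseEval, this] at hy

/-- The one-point extension of `X` obtained from `X ∪ C ⊆ βX` by collapsing `C` to a point. -/
def collapse [T35Space X] (hC : IsClosed C) (hCne : C.Nonempty)
    (hCX : C ⊆ (range stoneCechUnit)ᶜ) : OnePointExtension X :=
  letI : TopologicalSpace (Option X) := .induced (collapseEval C) inferInstance
  { carrier := Option X
    tychonoff := IsEmbedding.t35Space ⟨⟨rfl⟩, collapseEval_injective hC hCX⟩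
    emb := some
    isEmbedding := isEmbedding_some hC hCX
    denseRange := by
      rintro (_ | x)
      · obtain ⟨q, hq⟩ := hCne
        have := isDenseInducing_stoneCechUnit.comap_nhds_neBot q
        exact mem_closure_of_tendsto (tendsto_some_of_mem hq) (.of_forall mem_range_self)
      · exact subset_closure (mem_range_self x)
    pt := none
    compl_range := by ext (_ | x) <;> simp }

/-- A point off `C` is separated from `C` by a function equal to one on `C`; this function factors
through `βY`, so the point is not sent to `p`. A point of `C` is a limit of points of `X` that
converge to `p` in the new topology. -/
theorem fiber_collapse [T35Space X] (hC : IsClosed C) (hCne : C.Nonempty)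
    (hCX : C ⊆ (range stoneCechUnit)ᶜ) : (collapse hC hCne hCX).fiber = C := by
  set Y := collapse hC hCne hCX with hY
  ext q
  refine ⟨fun hq => ?_, fun hq => ?_⟩
  · by_contra hqC
    obtain ⟨f, hf, -⟩ := exists_functionsOneOn hC hqC isOpen_univ (mem_univ _)
    have hfc : Continuous fun y : Y.carrier => collapseEval C y f :=
      (continuous_apply f).comp continuous_induced_dom
    have heq : stoneCechExtend hfc ∘ Y.stoneCechMap = f.1 :=
      stoneCech_hom_ext ((continuous_stoneCechExtend _).comp Y.continuous_stoneCechMap)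
        f.1.continuous (funext fun x => by
          simp only [Function.comp_apply, stoneCechMap_stoneCechUnit, stoneCechExtend_stoneCechUnit]
          rfl)
    have h := congrFun heq q
    rw [Function.comp_apply, Y.mem_fiber.1 hq, stoneCechExtend_stoneCechUnit, hf] at h
    exact one_ne_zero h
  · have := isDenseInducing_stoneCechUnit.comap_nhds_neBot q
    have h₁ := (Y.continuous_stoneCechMap.tendsto q).comp
      (Filter.tendsto_comap : Filter.Tendsto (stoneCechUnit : X → _) _ (𝓝 q))
    have h₂ : Filter.Tendsto Y.emb (Filter.comap stoneCechUnit (𝓝 q)) (𝓝 Y.pt) :=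
      tendsto_some_of_mem hq
    exact tendsto_nhds_unique h₁ (((continuous_stoneCechUnit.tendsto _).comp h₂).congr fun x =>
      (Y.stoneCechMap_stoneCechUnit x).symm)

end Collapse

end OnePointExtension

/-! ### The two order isomorphisms with families of subsets of `σX \ X` -/

namespace OnePointExt

variable {X : Type u} [TopologicalSpace X]

/-- The set of points of `βX` that are mapped to the added point. -/
def fiber : OnePointExt X → Set (StoneCech X) :=
  Quotient.lift OnePointExtension.fiber fun Y₁ Y₂ h => Subset.antisymm
    ((Y₁.dominates_iff_fiber_subset Y₂).1 (OnePointExtension.Equivalent.dominates h))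
    ((Y₂.dominates_iff_fiber_subset Y₁).1
      (OnePointExtension.Equivalent.dominates (OnePointExtension.Equivalent.symm h)))

theorem le_iff_fiber_subset {p q : OnePointExt X} : p ≤ q ↔ q.fiber ⊆ p.fiber := by
  obtain ⟨Y₁⟩ := p
  obtain ⟨Y₂⟩ := q
  exact Y₂.dominates_iff_fiber_subset Y₁

theorem isClosed_fiber (q : OnePointExt X) : IsClosed q.fiber := by
  obtain ⟨Y⟩ := q
  exact Y.isClosed_fiber

theorem nonempty_fiber (q : OnePointExt X) : q.fiber.Nonempty := by
  obtain ⟨Y⟩ := q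
  exact Y.nonempty_fiber

theorem fiber_subset (q : OnePointExt X) : q.fiber ⊆ (range stoneCechUnit)ᶜ := by
  obtain ⟨Y⟩ := q
  exact Y.fiber_subset

theorem exists_fiber_eq [T35Space X] {C : Set (StoneCech X)} (hC : IsClosed C)
    (hCne : C.Nonempty) (hCX : C ⊆ (range stoneCechUnit)ᶜ) : ∃ q : OnePointExt X, q.fiber = C :=
  ⟨Quotient.mk _ (.collapse hC hCne hCX), OnePointExtension.fiber_collapse hC hCne hCX⟩

/-- A property that depends only on the fibre does not depend on the representative, so the
existential in the definitions of the classes can be dropped. -/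
theorem exists_mk_eq_iff {P : OnePointExtension X → Prop} {Q : Set (StoneCech X) → Prop}
    (h : ∀ Y, P Y ↔ Q Y.fiber) (q : OnePointExt X) :
    (∃ Y : OnePointExtension X, Quotient.mk _ Y = q ∧ P Y) ↔ Q q.fiber := by
  constructor
  · rintro ⟨Y, rfl, hY⟩
    exact (h Y).1 hY
  · obtain ⟨Y⟩ := q
    exact fun hq => ⟨Y, rfl, (h Y).2 hq⟩

variable [T2Space X] [LocallyCompactSpace X] [ParacompactSpace X]

theorem mem_starS_iff {q : OnePointExt X} :
    q ∈ starS X ↔ IsGδ q.fiber ∧ q.fiber ⊆ sigmaExt X :=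
  and_congr (exists_mk_eq_iff (fun Y => Y.isCountablyGenerated_nhds_pt_iff) q)
    (exists_mk_eq_iff (Q := (· ⊆ sigmaExt X)) (fun Y => Y.exists_isSigmaCompact_diff_pt_iff) q)

theorem mem_cechCompleteLindelof_iff {q : OnePointExt X} :
    q ∈ cechCompleteLindelof X ↔
      IsSigmaCompact ((range stoneCechUnit)ᶜ \ q.fiber) ∧ (sigmaExt X)ᶜ ⊆ q.fiber :=
  and_congr (exists_mk_eq_iff (Q := fun C => IsSigmaCompact ((range stoneCechUnit)ᶜ \ C))
      (fun Y => Y.isGδ_range_stoneCechUnit_iff) q)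
    (exists_mk_eq_iff (Q := ((sigmaExt X)ᶜ ⊆ ·)) (fun Y => Y.lindelofSpace_iff) q)

theorem fiber_subset_sigmaRemainder {q : OnePointExt X} (hq : q ∈ starS X) :
    q.fiber ⊆ range (Subtype.val : sigmaRemainder X → StoneCech X) := by
  rw [Subtype.range_coe]
  exact fun z hz => ⟨(mem_starS_iff.1 hq).2 hz, q.fiber_subset hz⟩

theorem compl_range_diff_fiber {q : OnePointExt X} (hq : q ∈ cechCompleteLindelof X) :
    Subtype.val '' (Subtype.val ⁻¹' q.fiberᶜ : Set (sigmaRemainder X)) =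
      (range stoneCechUnit)ᶜ \ q.fiber := by
  rw [image_preimage_eq_inter_range, Subtype.range_coe]
  ext z
  refine ⟨fun h => ⟨h.2.2, h.1⟩, fun h => ⟨h.2, ?_, h.1⟩⟩
  by_contra hz
  exact h.2 ((mem_cechCompleteLindelof_iff.1 hq).2 hz)

/-- The part of the fiber in `σX \ X`, as a compact `G_δ`-set. -/
def starSToCompactGδ (q : starS X) : CompactGδ (sigmaRemainder X) :=
  ⟨Subtype.val ⁻¹' q.1.fiber, by
    rw [IsEmbedding.subtypeVal.isCompact_iff,
      image_preimage_eq_of_subset (fiber_subset_sigmaRemainder q.2)]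
    exact q.1.isClosed_fiber.isCompact, (mem_starS_iff.1 q.2).1.preimage continuous_subtype_val,
    q.1.nonempty_fiber.preimage' (fiber_subset_sigmaRemainder q.2)⟩

theorem starSToCompactGδ_le_iff (p q : starS X) :
    starSToCompactGδ p ≤ starSToCompactGδ q ↔ q ≤ p := by
  rw [← Subtype.coe_le_coe, le_iff_fiber_subset]
  exact preimage_subset_preimage_iff (fiber_subset_sigmaRemainder p.2)

theorem starSToCompactGδ_surjective :
    Function.Surjective (starSToCompactGδ : starS X → CompactGδ (sigmaRemainder X)) := by
  rintro ⟨K, hK, hKg, hKne⟩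
  obtain ⟨q, hq⟩ := exists_fiber_eq (hK.image continuous_subtype_val).isClosed
    (hKne.image Subtype.val) (by rintro _ ⟨z, -, rfl⟩; exact z.2.2)
  refine ⟨⟨q, mem_starS_iff.2 ⟨hq ▸ isGδ_image_val_of_isCompact hK hKg, ?_⟩⟩, Subtype.ext ?_⟩
  · rw [hq]
    rintro _ ⟨z, -, rfl⟩
    exact z.2.1
  · change Subtype.val ⁻¹' q.fiber = K
    rw [hq, preimage_image_eq _ Subtype.val_injective]

variable (X) in
/-- `𝒯*_S(X)` is anti-isomorphic to the set of nonempty compact `G_δ`-subsets of `σX \ X`. -/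
noncomputable def starSOrderIso : starS X ≃o (CompactGδ (sigmaRemainder X))ᵒᵈ :=
  RelIso.ofSurjective
    (OrderEmbedding.ofMapLEIff (fun q => OrderDual.toDual (starSToCompactGδ q))
      fun p q => starSToCompactGδ_le_iff q p)
    starSToCompactGδ_surjective

/-- The complement of the fiber in `σX \ X`, as a proper open σ-compact set. -/
def cechCompleteLindelofToProperOpenSigma (q : cechCompleteLindelof X) :
    ProperOpenSigma (sigmaRemainder X) :=
  ⟨Subtype.val ⁻¹' q.1.fiberᶜ, q.1.isClosed_fiber.isOpen_compl.preimage continuous_subtype_val, by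
    rw [Subtype.isSigmaCompact_iff, compl_range_diff_fiber q.2]
    exact (mem_cechCompleteLindelof_iff.1 q.2).1, fun h => by
    -- If the fibre missed `σX \ X`, then `σX \ X` would be σ-compact, so all of `βX \ X` would lie
    -- in `σX`; the nonempty fibre would then meet `σX \ X` after all.
    have heq := compl_range_diff_fiber q.2
    rw [h, image_univ, Subtype.range_coe] at heq
    obtain ⟨z, hz⟩ := q.1.nonempty_fiber
    have hzS : z ∈ sigmaRemainder X := by
      refine ⟨compl_range_subset_sigmaExt_of_isSigmaCompact ?_ (q.1.fiber_subset hz),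
        q.1.fiber_subset hz⟩
      rw [heq]
      exact (mem_cechCompleteLindelof_iff.1 q.2).1
    rw [heq] at hzS
    exact hzS.2 hz⟩

theorem cechCompleteLindelofToProperOpenSigma_le_iff (p q : cechCompleteLindelof X) :
    cechCompleteLindelofToProperOpenSigma p ≤ cechCompleteLindelofToProperOpenSigma q ↔
      p ≤ q := by
  rw [← Subtype.coe_le_coe, le_iff_fiber_subset]
  change Subtype.val ⁻¹' p.1.fiberᶜ ⊆ Subtype.val ⁻¹' q.1.fiberᶜ ↔ _
  rw [← image_subset_image_iff Subtype.val_injective, compl_range_diff_fiber p.2,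
    compl_range_diff_fiber q.2]
  refine ⟨fun h z hz => ?_, fun h => sdiff_subset_sdiff_right h⟩
  by_contra hzp
  exact (h ⟨q.1.fiber_subset hz, hzp⟩).2 hz

theorem cechCompleteLindelofToProperOpenSigma_surjective :
    Function.Surjective (cechCompleteLindelofToProperOpenSigma :
      cechCompleteLindelof X → ProperOpenSigma (sigmaRemainder X)) := by
  rintro ⟨U, hU, hUs, hUne⟩
  obtain ⟨W, hW, rfl⟩ := isOpen_induced_iff.1 hU
  -- The fibre consists of `βX \ σX` together with the part of `σX \ X` outside `U`. It is closed
  -- because `σX` is open.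
  obtain ⟨q, hq⟩ := exists_fiber_eq (C := (range stoneCechUnit)ᶜ \ (W ∩ sigmaExt X))
    (isOpen_range_stoneCechUnit.isClosed_compl.sdiff (hW.inter isOpen_sigmaExt))
    (by
      obtain ⟨z, hz⟩ := (ne_univ_iff_exists_notMem _).1 hUne
      exact ⟨z, z.2.2, fun h => hz h.1⟩) sdiff_subset
  refine ⟨⟨q, mem_cechCompleteLindelof_iff.2 ⟨?_, ?_⟩⟩, Subtype.ext ?_⟩
  · rw [Subtype.isSigmaCompact_iff, image_preimage_eq_inter_range, Subtype.range_coe] at hUs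
    convert hUs using 1
    rw [hq, sdiff_sdiff_right_self, sigmaRemainder]
    ext z
    simp only [mem_inter_iff, mem_compl_iff, mem_sdiff]
    tauto
  · rw [hq]
    exact fun z hz => ⟨fun h => hz (range_stoneCechUnit_subset_sigmaExt h), fun h => hz h.2⟩
  · change Subtype.val ⁻¹' q.fiberᶜ = Subtype.val ⁻¹' W
    rw [hq]
    ext z
    simp only [mem_preimage, mem_compl_iff, mem_sdiff, mem_inter_iff]
    have := z.2.1
    have := z.2.2
    tauto

variable (X) in
/-- `𝒯_CL(X)` is isomorphic to the set of proper open σ-compact subsets of `σX \ X`. -/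
noncomputable def cechCompleteLindelofOrderIso :
    cechCompleteLindelof X ≃o ProperOpenSigma (sigmaRemainder X) :=
  RelIso.ofSurjective
    (OrderEmbedding.ofMapLEIff cechCompleteLindelofToProperOpenSigma
      cechCompleteLindelofToProperOpenSigma_le_iff)
    cechCompleteLindelofToProperOpenSigma_surjective

end OnePointExt

/-! ### The main theorem -/

theorem theorem3p16 (X : Type*) (Y : Type*)
    [TopologicalSpace X] [T2Space X] [LocallyCompactSpace X] [ParacompactSpace X]
    [TopologicalSpace Y] [T2Space Y] [LocallyCompactSpace Y] [ParacompactSpace Y] :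
    (Nonempty (OnePointExt.starS X ≃o OnePointExt.starS Y) ↔
      Nonempty (sigmaRemainder X ≃ₜ sigmaRemainder Y)) ∧
    (Nonempty (OnePointExt.cechCompleteLindelof X ≃o OnePointExt.cechCompleteLindelof Y) ↔
      Nonempty (sigmaRemainder X ≃ₜ sigmaRemainder Y)) := by
  refine ⟨⟨fun ⟨e⟩ => ?_, fun ⟨h⟩ => ?_⟩, ⟨fun ⟨e⟩ => ?_, fun ⟨h⟩ => ?_⟩⟩
  -- Both correspondences reverse the order, so the composite lives between order duals and is
  -- dualised back.
  · exact CompactGδ.nonempty_homeomorph (OrderIso.dual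
      (((OnePointExt.starSOrderIso X).symm.trans e).trans (OnePointExt.starSOrderIso Y)))
  · exact ⟨((OnePointExt.starSOrderIso X).trans h.compactGδCongr.dual).trans
      (OnePointExt.starSOrderIso Y).symm⟩
  · exact ProperOpenSigma.nonempty_homeomorph
      (((OnePointExt.cechCompleteLindelofOrderIso X).symm.trans e).trans
        (OnePointExt.cechCompleteLindelofOrderIso Y))
  · exact ⟨((OnePointExt.cechCompleteLindelofOrderIso X).trans h.properOpenSigmaCongr).trans
      (OnePointExt.cechCompleteLindelofOrderIso Y).symm⟩
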